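/- Let $X$ be a real Hilbert space, let $A,B\colon X\rightrightarrows X$ be maximally monotone operators such that $A+B$ is maximally monotone, and let $w\in X$. Write $\operatorname{zer} C=\{x\in X : 0\in Cx\}$ for an operator $C\colon X\rightrightarrows X$. For $\gamma\in\left]0,1\right[$ let $A_\gamma$ and $B_\gamma$ be the resolvent averages of $A$ and $B$ with the normal cone operator $N_{\{w\}}$, i.e. $$A_\gamma x = A\big(\gamma^{-1}(x-(1-\gamma)w)\big)+\gamma^{-1}(1-\gamma)(x-w),\qquad B_\gamma x = B\big(\gamma^{-1}(x-(1-\gamma)w)\big)+\gamma^{-1}(1-\gamma)(x-w)\qquad(x\in X).$$ Then for every $\gamma\in\left]0,1\right[$ the operator $A_\gamma+B_\gamma$ has exactly one zero $z_\gamma$, and exactly one of the following holds: 1. $\operatorname{zer}(A+B)\neq\varnothing$ and $z_\gamma\to P_{\operatorname{zer}(A+B)}w$ as $\gamma\to1^-$, where $P_{\operatorname{zer}(A+B)}w$ denotes the unique point of $\operatorname{zer}(A+B)$ nearest to $w$ (which exists in this case). 2. $\operatorname{zer}(A+B)=\varnothing$ and $\|z_\gamma\|\to\infty$ as $\gamma\to1^-$.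 -/

import Mathlib

open Filter Set
open scoped Topology Pointwise

namespace SetValuedOp

/-- The set-valued operator `A : X ⇉ X` is monotone. -/
def IsMonotone {X : Type*} [NormedAddCommGroup X] [InnerProductSpace ℝ X]
    (A : X → Set X) : Prop :=
  ∀ x y : X, ∀ u ∈ A x, ∀ v ∈ A y, 0 ≤ inner ℝ (x - y) (u - v)

/-- `A` is monotone and its graph is not properly contained in the graph of another monotone
operator. The order on `X → Set X` is pointwise inclusion, that is, inclusion of graphs. -/
def IsMaximallyMonotone {X : Type*} [NormedAddCommGroup X] [InnerProductSpace ℝ X]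
    (A : X → Set X) : Prop :=
  Maximal IsMonotone A

/-- The set of zeros of the operator `A`. -/
def zer {X : Type*} [Zero X] (A : X → Set X) : Set X :=
  {x | (0 : X) ∈ A x}

/-- The resolvent average `C_γ` of `C` and the normal cone operator of `{w}`:
`C_γ x = C (γ⁻¹ (x - (1 - γ) w)) + γ⁻¹ (1 - γ) (x - w)`. -/
def resolventAverage {X : Type*} [NormedAddCommGroup X] [InnerProductSpace ℝ X]
    (C : X → Set X) (w : X) (γ : ℝ) : X → Set X :=
  fun x => C (γ⁻¹ • (x - (1 - γ) • w)) + {(γ⁻¹ * (1 - γ)) • (x - w)}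

/-- The set of best approximations to `w` from `S`. -/
def nearestPoints {X : Type*} [NormedAddCommGroup X] (S : Set X) (w : X) : Set X :=
  {p | p ∈ S ∧ ∀ y ∈ S, ‖w - p‖ ≤ ‖w - y‖}

/-- `p = P_S w`: the point `p` is the unique best approximation to `w` from `S`. -/
def IsProjection {X : Type*} [NormedAddCommGroup X] (S : Set X) (w p : X) : Prop :=
  nearestPoints S w = {p}

end SetValuedOp

namespace SetValuedOp

/-! With `x = γ⁻¹(z - (1 - γ)w)` and `ε = 2(1 - γ)`, the zeros `z` become the solutions of `ε(w - x)
∈ (A + B)x`, a Tikhonov regularization. Minty's theorem gives existence and monotonicity gives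
uniqueness. As `ε` decreases to `0`, `‖w - x‖²` grows by at least the squared increment of `x`
(`norm_sub_sq_le`), so the curve is either Cauchy or unbounded. In the first case maximality makes
the limit a zero, and `norm_sub_sq_add_le` makes it the projection; in the second the same estimate,
which bounds `‖w - x‖` by the distance from `w` to any zero, excludes zeros. -/

variable {X : Type*} [NormedAddCommGroup X] [InnerProductSpace ℝ X]

/-! ### Minty's theorem -/

/-- A point monotonically related to the graph of a maximally monotone operator belongs to it. -/
theorem IsMaximallyMonotone.mem_of_forall {C : X → Set X} (hC : IsMaximallyMonotone C) {x u : X}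
    (h : ∀ y, ∀ v ∈ C y, 0 ≤ inner ℝ (x - y) (u - v)) : u ∈ C x := by
  have hmono : IsMonotone (fun z => C z ∪ {u' | z = x ∧ u' = u}) := by
    rintro a b p (hp | ⟨rfl, rfl⟩) q (hq | ⟨rfl, rfl⟩)
    · exact hC.1 a b p hp q hq
    · have := h a p hp
      rwa [← neg_sub b a, ← neg_sub q p, inner_neg_neg]
    · exact h b q hq
    · simp
  exact hC.2 hmono (fun z => subset_union_left) x (Or.inr ⟨rfl, rfl⟩)

/-- On the convex hull of the points `(y, v, ⟪y, v⟫)`, with `(y, v)` running over a monotone set,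
the last coordinate dominates the inner product of the first two. -/
theorem inner_le_of_mem_convexHull {G : Set (X × X)}
    (hG : ∀ p ∈ G, ∀ q ∈ G, 0 ≤ inner ℝ (p.1 - q.1) (p.2 - q.2)) {c : X × X × ℝ}
    (hc : c ∈ convexHull ℝ ((fun p : X × X => (p.1, p.2, inner ℝ p.1 p.2)) '' G)) :
    inner ℝ c.1 c.2.1 ≤ c.2.2 := by
  set S := (fun p : X × X => (p.1, p.2, (inner ℝ p.1 p.2 : ℝ))) '' G
  -- For `d`, `e` in `S` this expression is the monotonicity pairing. It is symmetric and affine in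
  -- each variable, so nonnegativity passes to the hull one variable at a time; `d = e = c` gives
  -- twice the claim.
  have hconv : ∀ d : X × X × ℝ, Convex ℝ
      {e : X × X × ℝ | 0 ≤ e.2.2 + d.2.2 - inner ℝ d.1 e.2.1 - inner ℝ d.2.1 e.1} := by
    intro d e he f hf s t hs ht hst
    simp only [mem_ofPred_eq, Prod.fst_add, Prod.snd_add, Prod.smul_fst, Prod.smul_snd,
      inner_add_right, real_inner_smul_right, smul_eq_mul] at he hf ⊢
    have h1 := mul_nonneg hs he
    have h2 := mul_nonneg ht hf
    have h3 : d.2.2 = s * d.2.2 + t * d.2.2 := by rw [← add_mul, hst, one_mul]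
    linarith
  have hpt : ∀ d ∈ S, ∀ e ∈ convexHull ℝ S,
      0 ≤ e.2.2 + d.2.2 - inner ℝ d.1 e.2.1 - inner ℝ d.2.1 e.1 := by
    rintro _ ⟨p, hp, rfl⟩ e he
    refine convexHull_min ?_ (hconv _) he
    rintro _ ⟨q, hq, rfl⟩
    have := hG p hp q hq
    simp only [inner_sub_left, inner_sub_right] at this
    simp only [mem_ofPred_eq]
    rw [real_inner_comm q.1 p.2]
    linarith
  have hself : 0 ≤ c.2.2 + c.2.2 - inner ℝ c.1 c.2.1 - inner ℝ c.2.1 c.1 := by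
    refine convexHull_min ?_ (hconv c) hc
    intro d hd
    have := hpt d hd c hc
    simp only [mem_ofPred_eq]
    rw [real_inner_comm d.2.1 c.1, real_inner_comm d.1 c.2.1]
    linarith
  rw [real_inner_comm c.1 c.2.1] at hself
  linarith

/-- A lower bounded function `(q, s) ↦ ‖q‖ ^ 2 + s` on a nonempty convex set has a generalized
minimizer, at which the first-order optimality condition holds. -/
theorem exists_forall_two_inner_sub_le [CompleteSpace X] {K : Set (X × ℝ)} (hK : Convex ℝ K)
    (hne : K.Nonempty) (hnonneg : ∀ k ∈ K, 0 ≤ ‖k.1‖ ^ 2 + k.2) :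
    ∃ x : X, ∀ k ∈ K, ‖x‖ ^ 2 ≤ 2 * inner ℝ x k.1 + k.2 := by
  set f : X × ℝ → ℝ := fun k => ‖k.1‖ ^ 2 + k.2 with hf
  set m := sInf (f '' K)
  have hbdd : BddBelow (f '' K) := ⟨0, by rintro _ ⟨k, hk, rfl⟩; exact hnonneg k hk⟩
  have hm : ∀ k ∈ K, m ≤ f k := fun k hk => csInf_le hbdd ⟨k, hk, rfl⟩
  have hm0 : 0 ≤ m := le_csInf (hne.image f) (by rintro _ ⟨k, hk, rfl⟩; exact hnonneg k hk)
  obtain ⟨u, -, hu, huK⟩ := exists_seq_tendsto_sInf (hne.image f) hbdd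
  choose k hkK hku using huK
  have hfk : Tendsto (fun n => f (k n)) atTop (𝓝 m) := by simpa only [hku] using hu
  -- Strong convexity of the squared norm: `t = 1 / 2` makes minimizing sequences Cauchy, and `t →
  -- 0` gives the optimality condition.
  have hcomb : ∀ a ∈ K, ∀ b ∈ K, ∀ t ∈ Icc (0 : ℝ) 1,
      m ≤ (1 - t) * f a + t * f b - t * (1 - t) * ‖a.1 - b.1‖ ^ 2 := by
    intro a ha b hb t ht
    have h := hm _ (hK ha hb (sub_nonneg.2 ht.2) ht.1 (by ring))
    refine h.trans (le_of_eq ?_)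
    simp only [hf, Prod.fst_add, Prod.snd_add, Prod.smul_fst, Prod.smul_snd, smul_eq_mul,
      norm_add_sq_real, norm_sub_sq_real, norm_smul, real_inner_smul_left, real_inner_smul_right,
      mul_pow, Real.norm_eq_abs, sq_abs]
    ring
  have hcauchy : CauchySeq (fun n => (k n).1) := by
    rw [Metric.cauchySeq_iff']
    intro ε hε
    have hev := hfk.eventually (gt_mem_nhds (show m < m + ε ^ 2 / 4 by linarith [pow_pos hε 2]))
    obtain ⟨N, hN⟩ := eventually_atTop.1 hev
    refine ⟨N, fun n hn => ?_⟩
    have h := hcomb _ (hkK n) _ (hkK N) (1 / 2) ⟨by norm_num, by norm_num⟩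
    have h1 := hN n hn
    have h2 := hN N le_rfl
    rw [dist_eq_norm]
    refine lt_of_pow_lt_pow_left₀ 2 hε.le ?_
    linarith
  obtain ⟨x, hx⟩ := cauchySeq_tendsto_of_complete hcauchy
  refine ⟨x, fun b hb => ?_⟩
  have hlim : ∀ t ∈ Ioo (0 : ℝ) 1, (1 - t) * ‖x - b.1‖ ^ 2 ≤ f b - m := by
    intro t ht
    have h : m ≤ (1 - t) * m + t * f b - t * (1 - t) * ‖x - b.1‖ ^ 2 := by
      refine ge_of_tendsto' (((hfk.const_mul (1 - t)).add_const (t * f b)).sub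
        (((hx.sub_const b.1).norm.pow 2).const_mul (t * (1 - t)))) fun n => ?_
      exact hcomb _ (hkK n) _ hb t ⟨ht.1.le, ht.2.le⟩
    have : t * ((1 - t) * ‖x - b.1‖ ^ 2) ≤ t * (f b - m) := by linarith
    exact le_of_mul_le_mul_left this ht.1
  have h0 : ‖x - b.1‖ ^ 2 ≤ f b - m := by
    have hc : Tendsto (fun t : ℝ => (1 - t) * ‖x - b.1‖ ^ 2) (𝓝[>] 0)
        (𝓝 ((1 - 0) * ‖x - b.1‖ ^ 2)) :=
      (Continuous.tendsto (by fun_prop) 0).mono_left nhdsWithin_le_nhds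
    rw [sub_zero, one_mul] at hc
    exact le_of_tendsto hc (eventually_of_mem (Ioo_mem_nhdsGT one_pos) hlim)
  simp only [hf, norm_sub_sq_real] at h0
  linarith

/-- Every monotone set admits a point `x` such that `(x, -x)` is monotonically related to it. -/
theorem exists_forall_inner_nonneg [CompleteSpace X] {G : Set (X × X)}
    (hG : ∀ p ∈ G, ∀ q ∈ G, 0 ≤ inner ℝ (p.1 - q.1) (p.2 - q.2)) :
    ∃ x : X, ∀ p ∈ G, 0 ≤ inner ℝ (x - p.1) (-x - p.2) := by
  rcases G.eq_empty_or_nonempty with rfl | hne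
  · exact ⟨0, by simp⟩
  set S := (fun p : X × X => (p.1, p.2, (inner ℝ p.1 p.2 : ℝ))) '' G
  -- Chosen because `‖(y - v)/2‖² + ⟪y, v⟫ = ‖(y + v)/2‖² ≥ 0`, while optimality at `x` expands to
  -- `⟪x - y, -x - v⟫ ≥ 0`.
  let L : X × X × ℝ →ₗ[ℝ] X × ℝ :=
    { toFun := fun c => ((1 / 2 : ℝ) • (c.1 - c.2.1), c.2.2)
      map_add' := fun a b => by
        ext
        · simp only [Prod.fst_add, Prod.snd_add, ← smul_add]; congr 1; abel
        · simp
      map_smul' := fun r a => by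
        ext
        · simp only [Prod.smul_fst, Prod.smul_snd, RingHom.id_apply, ← smul_sub]
          exact smul_comm _ _ _
        · simp }
  obtain ⟨x, hx⟩ := exists_forall_two_inner_sub_le (K := L '' convexHull ℝ S)
    ((convex_convexHull ℝ S).linear_image L)
    (((hne.image _).mono (subset_convexHull ℝ S)).image L) (by
      rintro _ ⟨c, hc, rfl⟩
      have h := inner_le_of_mem_convexHull hG hc
      have h4 : ‖c.1 - c.2.1‖ ^ 2 = ‖c.1 + c.2.1‖ ^ 2 - 4 * inner ℝ c.1 c.2.1 := by
        rw [norm_sub_sq_real, norm_add_sq_real]; ring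
      change 0 ≤ ‖(1 / 2 : ℝ) • (c.1 - c.2.1)‖ ^ 2 + c.2.2
      rw [norm_smul, mul_pow, h4]
      norm_num
      nlinarith [sq_nonneg ‖c.1 + c.2.1‖])
  refine ⟨x, fun p hp => ?_⟩
  have h := hx _ ⟨_, subset_convexHull ℝ S ⟨p, hp, rfl⟩, rfl⟩
  change ‖x‖ ^ 2 ≤ 2 * inner ℝ x ((1 / 2 : ℝ) • (p.1 - p.2)) + inner ℝ p.1 p.2 at h
  rw [real_inner_smul_right, inner_sub_right] at h
  simp only [inner_sub_left, inner_sub_right, inner_neg_right, real_inner_self_eq_norm_sq]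
  rw [real_inner_comm x p.1]
  linarith

/-- Minty's theorem: the resolvent of a maximally monotone operator is everywhere defined. -/
theorem IsMaximallyMonotone.exists_smul_sub_mem [CompleteSpace X] {C : X → Set X}
    (hC : IsMaximallyMonotone C) (w : X) {ε : ℝ} (hε : 0 < ε) : ∃ x, ε • (w - x) ∈ C x := by
  -- The graph of `y ↦ ε⁻¹ C(y + w)` reduces to the case `w = 0`, `ε = 1`.
  obtain ⟨x, hx⟩ := exists_forall_inner_nonneg (X := X)
    (G := {p | ε • p.2 ∈ C (p.1 + w)}) (by
      intro p hp q hq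
      have h := hC.1 _ _ _ hp _ hq
      rw [add_sub_add_right_eq_sub, ← smul_sub, real_inner_smul_right] at h
      exact nonneg_of_mul_nonneg_right h hε)
  refine ⟨x + w, hC.mem_of_forall fun y v hv => ?_⟩
  have h := hx (y - w, ε⁻¹ • v) (by simpa [smul_smul, hε.ne'] using hv)
  have h' := mul_nonneg hε.le h
  rw [← real_inner_smul_right] at h'
  have h1 : x + w - y = x - (y - w) := by abel
  have h2 : ε • (w - (x + w)) - v = ε • (-x - ε⁻¹ • v) := by
    rw [smul_sub ε (-x), smul_inv_smul₀ hε.ne', sub_add_cancel_right]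
  rwa [h1, h2]

/-! ### The curve of resolvents -/

/-- The resolvent of a monotone operator is single-valued. -/
theorem IsMonotone.eq_of_smul_sub_mem {C : X → Set X} (hC : IsMonotone C) {w : X} {ε : ℝ}
    (hε : 0 < ε) {x y : X} (hx : ε • (w - x) ∈ C x) (hy : ε • (w - y) ∈ C y) : x = y := by
  have h := hC x y _ hx _ hy
  have he : ε • (w - x) - ε • (w - y) = (-ε) • (x - y) := by module
  rw [he, real_inner_smul_right, real_inner_self_eq_norm_sq] at h
  have : ‖x - y‖ ^ 2 ≤ 0 := by
    by_contra! hlt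
    nlinarith
  rw [← sub_eq_zero, ← norm_eq_zero]
  exact pow_eq_zero_iff two_ne_zero |>.1 (le_antisymm this (sq_nonneg _))

/-- The key estimate on the curve of resolvents. -/
theorem IsMonotone.norm_sub_sq_le {C : X → Set X} (hC : IsMonotone C) {w : X} {ε δ : ℝ}
    (hε : 0 < ε) (hεδ : ε < δ) {x y : X} (hx : ε • (w - x) ∈ C x) (hy : δ • (w - y) ∈ C y) :
    ‖(w - x) - (w - y)‖ ^ 2 ≤ ‖w - x‖ ^ 2 - ‖w - y‖ ^ 2 := by
  have h := hC x y _ hx _ hy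
  obtain ⟨a, rfl⟩ : ∃ a, x = w - a := ⟨w - x, by abel⟩
  obtain ⟨b, rfl⟩ : ∃ b, y = w - b := ⟨w - y, by abel⟩
  simp only [sub_sub_cancel, sub_sub_sub_cancel_left] at h ⊢
  have he : ε • a - δ • b = ε • (a - b) - (δ - ε) • b := by module
  have hb : inner ℝ (b - a) (a - b) = -‖a - b‖ ^ 2 := by
    rw [← neg_sub a b, inner_neg_left, real_inner_self_eq_norm_sq]
  rw [he, inner_sub_right, real_inner_smul_right, real_inner_smul_right, hb] at h
  -- Monotonicity reads `(δ - ε)⟪b - a, b⟫ ≤ -ε‖a - b‖²`.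
  have hs : inner ℝ (b - a) b ≤ 0 := by
    by_contra! hlt
    nlinarith [mul_pos (sub_pos.2 hεδ) hlt, mul_nonneg hε.le (sq_nonneg ‖a - b‖)]
  rw [inner_sub_left, real_inner_self_eq_norm_sq] at hs
  rw [norm_sub_sq_real]
  linarith

/-- A solution of the regularized inclusion is closer to `w` than any zero. -/
theorem IsMonotone.norm_sub_sq_add_le {C : X → Set X} (hC : IsMonotone C) {w : X} {ε : ℝ}
    (hε : 0 < ε) {x y : X} (hx : ε • (w - x) ∈ C x) (hy : y ∈ zer C) :
    ‖w - x‖ ^ 2 + ‖x - y‖ ^ 2 ≤ ‖w - y‖ ^ 2 := by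
  have h := hC x y _ hx _ hy
  rw [sub_zero, real_inner_smul_right] at h
  have h' := nonneg_of_mul_nonneg_right h hε
  rw [show w - y = (x - y) + (w - x) by abel, norm_add_sq_real]
  linarith

/-- A curve whose squared increments are dominated by the increments of its squared norm either
converges or blows up at the right end of its interval. -/
theorem exists_tendsto_or_tendsto_norm_atTop {E : Type*} [NormedAddCommGroup E] [CompleteSpace E]
    {a : ℝ → E}
    (ha : ∀ s ∈ Ioo (0 : ℝ) 1, ∀ t ∈ Ioo (0 : ℝ) 1, s < t →
      ‖a t - a s‖ ^ 2 ≤ ‖a t‖ ^ 2 - ‖a s‖ ^ 2) :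
    (∃ l, Tendsto a (𝓝[<] 1) (𝓝 l)) ∨ Tendsto (fun t => ‖a t‖) (𝓝[<] 1) atTop := by
  have hmono : ∀ s ∈ Ioo (0 : ℝ) 1, ∀ t ∈ Ioo (0 : ℝ) 1, s ≤ t → ‖a s‖ ≤ ‖a t‖ := by
    intro s hs t ht hst
    rcases hst.eq_or_lt with rfl | hlt
    · exact le_rfl
    · have := ha s hs t ht hlt
      exact le_of_sq_le_sq (by nlinarith [sq_nonneg ‖a t - a s‖]) (norm_nonneg _)
  by_cases hb : BddAbove ((fun t => ‖a t‖ ^ 2) '' Ioo 0 1)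
  · left
    set M := sSup ((fun t => ‖a t‖ ^ 2) '' Ioo 0 1)
    have hle : ∀ t ∈ Ioo (0 : ℝ) 1, ‖a t‖ ^ 2 ≤ M := fun t ht => le_csSup hb ⟨t, ht, rfl⟩
    refine cauchy_map_iff_exists_tendsto.1 (Metric.cauchy_iff.2 ⟨inferInstance, fun ε hε => ?_⟩)
    have hne : ((fun t => ‖a t‖ ^ 2) '' Ioo (0 : ℝ) 1).Nonempty := ⟨_, 1 / 2, by norm_num, rfl⟩
    obtain ⟨_, ⟨r, hr, rfl⟩, hrM⟩ :=
      exists_lt_of_lt_csSup hne (show M - ε ^ 2 < M by linarith [pow_pos hε 2])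
    have hlt : ∀ s ∈ Ioo r 1, ∀ t ∈ Ioo r 1, s ≤ t → dist (a t) (a s) < ε := by
      intro s hs t ht hst
      rcases hst.eq_or_lt with rfl | hlt
      · simpa using hε
      have hs' : s ∈ Ioo (0 : ℝ) 1 := ⟨hr.1.trans hs.1, hs.2⟩
      have ht' : t ∈ Ioo (0 : ℝ) 1 := ⟨hr.1.trans ht.1, ht.2⟩
      have h1 := ha s hs' t ht' hlt
      have h2 := hle t ht'
      have h3 := pow_le_pow_left₀ (norm_nonneg _) (hmono r hr s hs' hs.1.le) 2
      rw [dist_eq_norm]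
      refine lt_of_pow_lt_pow_left₀ 2 hε.le ?_
      simp only at hrM
      linarith
    refine ⟨a '' Ioo r 1, image_mem_map (Ioo_mem_nhdsLT hr.2), ?_⟩
    rintro _ ⟨s, hs, rfl⟩ _ ⟨t, ht, rfl⟩
    rcases le_total s t with h | h
    · rw [dist_comm]; exact hlt s hs t ht h
    · exact hlt t ht s hs h
  · right
    refine tendsto_atTop.2 fun c => ?_
    obtain ⟨_, ⟨r, hr, rfl⟩, hrc⟩ := not_bddAbove_iff.1 hb (c ^ 2)
    filter_upwards [Ioo_mem_nhdsLT hr.2] with t ht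
    exact (le_of_sq_le_sq hrc.le (norm_nonneg _)).trans
      (hmono r hr t ⟨hr.1.trans ht.1, ht.2⟩ ht.1.le)

/-- The limit of the curve of resolvents, as the parameter tends to zero, is the projection of `w`
onto the set of zeros. -/
theorem IsMaximallyMonotone.isProjection_of_tendsto {C : X → Set X} (hC : IsMaximallyMonotone C)
    {ι : Type*} {l : Filter ι} [l.NeBot] {w p : X} {ε : ι → ℝ} {x : ι → X}
    (hε : Tendsto ε l (𝓝 0)) (hx : Tendsto x l (𝓝 p))
    (h : ∀ᶠ i in l, 0 < ε i ∧ ε i • (w - x i) ∈ C (x i)) :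
    p ∈ zer C ∧ IsProjection (zer C) w p := by
  have hp : p ∈ zer C := by
    refine hC.mem_of_forall fun y v hv => ?_
    have hlim : Tendsto (fun i => inner ℝ (x i - y) (ε i • (w - x i) - v)) l
        (𝓝 (inner ℝ (p - y) ((0 : ℝ) • (w - p) - v))) :=
      (hx.sub_const y).inner ((hε.smul (hx.const_sub w)).sub_const v)
    rw [zero_smul] at hlim
    exact ge_of_tendsto hlim (h.mono fun i hi => hC.1 _ _ _ hi.2 _ hv)
  have hineq : ∀ y ∈ zer C, ‖w - p‖ ^ 2 + ‖p - y‖ ^ 2 ≤ ‖w - y‖ ^ 2 := fun y hy =>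
    le_of_tendsto (((hx.const_sub w).norm.pow 2).add ((hx.sub_const y).norm.pow 2))
      (h.mono fun i hi => hC.1.norm_sub_sq_add_le hi.1 hi.2 hy)
  refine ⟨hp, Subset.antisymm ?_ ?_⟩
  · rintro q ⟨hq, hmin⟩
    have h1 := hineq q hq
    have h2 := pow_le_pow_left₀ (norm_nonneg _) (hmin p hp) 2
    have h3 : ‖p - q‖ ^ 2 = 0 := le_antisymm (by linarith) (sq_nonneg _)
    rw [pow_eq_zero_iff two_ne_zero, norm_eq_zero, sub_eq_zero] at h3
    exact h3.symm
  · rw [singleton_subset_iff]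
    exact ⟨hp, fun y hy => le_of_sq_le_sq
      (by nlinarith [hineq y hy, sq_nonneg ‖p - y‖]) (norm_nonneg _)⟩

/-! ### Resolvent averages and the dichotomy -/

/-- Zeros of the sum of the resolvent averages correspond to solutions of a regularized inclusion
for the sum of the operators. -/
theorem mem_zer_resolventAverage_add_iff {A B : X → Set X} {w z : X} {γ : ℝ} (hγ : γ ≠ 0) :
    z ∈ zer (fun x => resolventAverage A w γ x + resolventAverage B w γ x) ↔
      (2 * (1 - γ)) • (w - γ⁻¹ • (z - (1 - γ) • w)) ∈
        A (γ⁻¹ • (z - (1 - γ) • w)) + B (γ⁻¹ • (z - (1 - γ) • w)) := by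
  have key : (2 * (1 - γ)) • (w - γ⁻¹ • (z - (1 - γ) • w)) =
      -((γ⁻¹ * (1 - γ)) • (z - w) + (γ⁻¹ * (1 - γ)) • (z - w)) := by
    match_scalars <;> field_simp <;> ring
  rw [key]
  simp only [zer, resolventAverage, mem_ofPred_eq]
  rw [add_add_add_comm, singleton_add_singleton]
  rw [Set.mem_add]
  simp only [mem_singleton_iff, exists_eq_left, ← eq_neg_iff_add_eq_zero, exists_eq_right]

end SetValuedOp

theorem theorem3p4 {X : Type*} [NormedAddCommGroup X] [InnerProductSpace ℝ X] [CompleteSpace X]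
    (A B : X → Set X) (w : X)
    (hA : SetValuedOp.IsMaximallyMonotone A)
    (hB : SetValuedOp.IsMaximallyMonotone B)
    (hAB : SetValuedOp.IsMaximallyMonotone (fun x => A x + B x)) :
    (∀ γ ∈ Ioo (0 : ℝ) 1, ∃! z : X,
      z ∈ SetValuedOp.zer (fun x => SetValuedOp.resolventAverage A w γ x +
        SetValuedOp.resolventAverage B w γ x)) ∧
    ∀ z : ℝ → X,
      (∀ γ ∈ Ioo (0 : ℝ) 1,
        SetValuedOp.zer (fun x => SetValuedOp.resolventAverage A w γ x +
          SetValuedOp.resolventAverage B w γ x) = {z γ}) →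
      Xor
        ((SetValuedOp.zer (fun x => A x + B x)).Nonempty ∧
          ∃ p : X, SetValuedOp.IsProjection (SetValuedOp.zer (fun x => A x + B x)) w p ∧
            Tendsto z (𝓝[<] 1) (𝓝 p))
        (SetValuedOp.zer (fun x => A x + B x) = ∅ ∧
          Tendsto (fun γ => ‖z γ‖) (𝓝[<] 1) atTop) := by
  have hpos : ∀ γ ∈ Ioo (0 : ℝ) 1, 0 < 2 * (1 - γ) := fun γ hγ => by linarith [hγ.2]
  refine ⟨fun γ hγ => ?_, fun z hz => ?_⟩
  · obtain ⟨x, hx⟩ := hAB.exists_smul_sub_mem w (hpos γ hγ)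
    have hinv : γ⁻¹ • (γ • x + (1 - γ) • w - (1 - γ) • w) = x := by
      rw [add_sub_cancel_right, inv_smul_smul₀ hγ.1.ne']
    refine ⟨γ • x + (1 - γ) • w, ?_, fun y hy => ?_⟩
    · simp only
      rwa [SetValuedOp.mem_zer_resolventAverage_add_iff hγ.1.ne', hinv]
    · have hy' := (SetValuedOp.mem_zer_resolventAverage_add_iff hγ.1.ne').1 hy
      rw [← hAB.1.eq_of_smul_sub_mem (hpos γ hγ) hy' hx, smul_inv_smul₀ hγ.1.ne', sub_add_cancel]
  have hIoo : ∀ᶠ γ in 𝓝[<] (1 : ℝ), γ ∈ Ioo (0 : ℝ) 1 := Ioo_mem_nhdsLT one_pos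
  set x : ℝ → X := fun γ => γ⁻¹ • (z γ - (1 - γ) • w) with hxdef
  have hx : ∀ γ ∈ Ioo (0 : ℝ) 1, (2 * (1 - γ)) • (w - x γ) ∈ A (x γ) + B (x γ) := fun γ hγ =>
    (SetValuedOp.mem_zer_resolventAverage_add_iff hγ.1.ne').1 (by rw [hz γ hγ]; rfl)
  have hzx : ∀ γ ∈ Ioo (0 : ℝ) 1, z γ = γ • x γ + (1 - γ) • w := fun γ hγ => by
    rw [hxdef, smul_inv_smul₀ hγ.1.ne', sub_add_cancel]
  have hid : Tendsto (fun γ : ℝ => γ) (𝓝[<] 1) (𝓝 1) := tendsto_id.mono_left nhdsWithin_le_nhds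
  -- A larger `γ` means a smaller `2(1 - γ)`, hence the swap of `s` and `t`.
  have hdich := SetValuedOp.exists_tendsto_or_tendsto_norm_atTop (a := fun γ => w - x γ)
    fun s hs t ht hst => hAB.1.norm_sub_sq_le (hpos t ht) (by linarith) (hx t ht) (hx s hs)
  rcases hdich with ⟨l, hl⟩ | htop
  · have hxl : Tendsto x (𝓝[<] 1) (𝓝 (w - l)) := by
      simpa using hl.const_sub w
    have hε : Tendsto (fun γ : ℝ => 2 * (1 - γ)) (𝓝[<] 1) (𝓝 0) := by
      simpa using (hid.const_sub 1).const_mul 2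
    obtain ⟨hmem, hproj⟩ := hAB.isProjection_of_tendsto hε hxl
      (hIoo.mono fun γ hγ => ⟨hpos γ hγ, hx γ hγ⟩)
    refine Or.inl ⟨⟨⟨_, hmem⟩, _, hproj, ?_⟩, fun h => ?_⟩
    · have hlim : Tendsto (fun γ => γ • x γ + (1 - γ) • w) (𝓝[<] 1) (𝓝 (w - l)) := by
        simpa using (hid.smul hxl).add ((hid.const_sub 1).smul_const w)
      exact hlim.congr' (hIoo.mono fun γ hγ => (hzx γ hγ).symm)
    · exact (h.1 ▸ hmem : w - l ∈ (∅ : Set X))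
  · have hempty : SetValuedOp.zer (fun x => A x + B x) = ∅ := by
      refine eq_empty_of_forall_notMem fun y hy => ?_
      obtain ⟨γ, hγ, hlt⟩ := (hIoo.and (htop.eventually_gt_atTop ‖w - y‖)).exists
      have h := hAB.1.norm_sub_sq_add_le (hpos γ hγ) (hx γ hγ) hy
      have h2 := pow_lt_pow_left₀ hlt (norm_nonneg _) two_ne_zero
      linarith [sq_nonneg ‖x γ - y‖]
    refine Or.inr ⟨⟨hempty, ?_⟩, fun h => h.1.ne_empty hempty⟩
    have hmul : Tendsto (fun γ => γ * ‖w - x γ‖ - ‖w‖) (𝓝[<] 1) atTop :=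
      tendsto_atTop_add_const_right _ _ (hid.pos_mul_atTop one_pos htop)
    refine tendsto_atTop_mono' _ (hIoo.mono fun γ hγ => ?_) hmul
    have he : γ • (w - x γ) = w - z γ := by
      rw [hzx γ hγ]; module
    have hn : γ * ‖w - x γ‖ = ‖w - z γ‖ := by
      rw [← he, norm_smul, Real.norm_of_nonneg hγ.1.le]
    rw [hn]
    linarith [norm_sub_le w (z γ)]
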